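/- Let $K$ and $L$ be number fields with rings of integers $O_K$, $O_L$, let $E$ be a compositum of $K$ and $L$ (a number field with embeddings $\iota_K: K\to E$ and $\iota_L: L\to E$ whose images together generate $E$), and let $\phi: K\to L$ be a $\mathbb{Q}$-linear isomorphism with $\mathrm{Tr}_{L/\mathbb{Q}}(\phi(x)\phi(y))=\mathrm{Tr}_{K/\mathbb{Q}}(xy)$ for all $x,y\in K$ and $\phi(O_K)=O_L$. Let $c\in E$ be the Casimir element $c=\langle \iota_K,\iota_L\phi\rangle_{\mathrm{tr}_{K/\mathbb{Q}}}$, that is, the image of the identity under the linear map $\mathrm{End}_{\mathbb{Q}}(K)\cong K^*\otimes_{\mathbb{Q}}K\to E$, $f\otimes v\mapsto \iota_K(\Gamma^{-1}(f))\,\iota_L(\phi(v))$, where $K^*=\mathrm{Hom}_{\mathbb{Q}}(K,\mathbb{Q})$ and $\Gamma: K\to K^*$ is the isomorphism $x\mapsto \mathrm{Tr}_{K/\mathbb{Q}}(x\,\cdot\,)$. Equivalently, $c=\sum_i \iota_K(v_i^*)\,\iota_L(\phi(v_i))$ for any $\mathbb{Q}$-basis $(v_i)$ of $K$ with dual basis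 $(v_i^*)$ with respect to the trace form. Write the discriminant $d_K$ of $K$ as $d_K=d_s d_f$, where $d_f$ is the product of the primes dividing $d_K$ exactly once. For a nonzero integer $m$ let $\mathrm{rad}(m)$ be the product of the distinct primes dividing $m$. Then: 1. $d_s c$ is an algebraic integer. 2. If $K$ has no wild ramification (that is, for every rational prime $p$ and every prime $\mathfrak{p}$ of $O_K$ over $p$, the ramification index $e(\mathfrak{p}|p)$ is not divisible by $p$), then $\mathrm{rad}(d_s)\,c$ is an algebraic integer. 3. In particular, if $d_K$ is squarefree, then $c$ is an algebraic integer. -/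

import Mathlib

open scoped TensorProduct

noncomputable section

/-- For an isomorphism `Γ : V ≃ V*` and `F`-linear maps `ψ, φ : V → R` into an `F`-algebra, the
linear map `End(V) ≅ V* ⊗ V → R` induced by `f ⊗ v ↦ ψ (Γ⁻¹ f) * φ v`. -/
def casimirRho {F V R : Type*} [Field F] [AddCommGroup V] [Module F V] [FiniteDimensional F V]
    [Ring R] [Algebra F R] (Γ : V ≃ₗ[F] Module.Dual F V) (ψ φ : V →ₗ[F] R) :
    Module.End F V →ₗ[F] R :=
  TensorProduct.lift ((LinearMap.mul F R).compl₁₂ (ψ ∘ₗ Γ.symm.toLinearMap) φ) ∘ₗ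
    (dualTensorHomEquiv F V V).symm.toLinearMap

/-- The Casimir pairing `⟨ψ, φ⟩_Γ`: the image of the identity endomorphism under `casimirRho`. -/
def casimirPairing {F V R : Type*} [Field F] [AddCommGroup V] [Module F V] [FiniteDimensional F V]
    [Ring R] [Algebra F R] (Γ : V ≃ₗ[F] Module.Dual F V) (ψ φ : V →ₗ[F] R) : R :=
  casimirRho Γ ψ φ 1

/-- The Casimir pairing on `Hom_F(K, R)` associated to the trace pairing of a finite separable
field extension `K / F`. -/
def traceCasimirPairing (F K : Type*) {R : Type*} [Field F] [Field K] [Algebra F K]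
    [FiniteDimensional F K] [Algebra.IsSeparable F K] [Ring R] [Algebra F R]
    (ψ φ : K →ₗ[F] R) : R :=
  casimirPairing
    (LinearMap.BilinForm.toDual (Algebra.traceForm F K) (traceForm_nondegenerate F K)) ψ φ

/-- An isometry `(K, tr_{K/ℚ}) ≃ (L, tr_{L/ℚ})` that carries the maximal order of `K` onto the
maximal order of `L`. -/
structure IsIntegralTraceIsometry {K L : Type*} [Field K] [NumberField K] [Field L] [NumberField L]
    (φ : K ≃ₗ[ℚ] L) : Prop where
  trace_eq : ∀ x y : K, Algebra.trace ℚ L (φ x * φ y) = Algebra.trace ℚ K (x * y)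
  image_integers : φ '' {x : K | IsIntegral ℤ x} = {y : L | IsIntegral ℤ y}

/-- The product of the primes that divide the integer `d` exactly once. -/
def exactPrimePart (d : ℤ) : ℕ :=
  ∏ p ∈ d.natAbs.primeFactors with ¬ p ^ 2 ∣ d.natAbs, p

/-- `K` has no wild ramification: no ramification index of a nonzero prime of `𝓞 K` is divisible by
the rational prime `p` below it. -/
def NoWildRamification (K : Type*) [Field K] [NumberField K] : Prop :=
  ∀ (p : ℕ) (P : Ideal (NumberField.RingOfIntegers K)), p.Prime → P.IsPrime →
    P.LiesOver (Ideal.span {(p : ℤ)}) →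
    ¬ p ∣ Ideal.ramificationIdx' (Ideal.span {(p : ℤ)}) P

end

/-! Integrality is checked at each prime `p` separately: some multiple by an `m` prime to `p` must
be integral (`isIntegral_of_forall_prime`). Let `D` be the different of `K` and `j = ιL ∘ φ`. For an
integral basis `vᵢ` the duals `vᵢ*` lie in `D⁻¹`, so `n c` is integral for every integer `n ∈ D`.
Taking `n = |d_K| = N(D)` settles the primes that do not divide `d_K` exactly once, up to the factor
`ds`; at a tame prime `D` divides `p` locally, so one factor `p` suffices.

The main case is `p` dividing `d_K` exactly once (`exists_isIntegral_mul_traceCasimirPairing`).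
There `D⁻¹/𝓞 K` is cyclic at `p`, generated by some `w`. Up to factors prime to `p`, `vᵢ* ≡ tᵢ w`
modulo integers, so `c ≡ ιK(w) j(y)` with `y = ∑ tᵢ vᵢ`. Duality forces `y ∈ p D⁻¹`, hence `c ≡ t' p
ιK(w) j(w)`. The square of `p ιK(w) j(w)` is the product of `p w²` and `p j(w)²`, both integral at
`p`: locally the inverse different is `P⁻¹` with `P² ∣ p`, and `φ` preserves inverse different and
discriminant. -/

open scoped nonZeroDivisors NumberField

section Different

attribute [local instance] FractionRing.liftAlgebra FractionRing.isScalarTower_liftAlgebra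
  Ideal.Quotient.field

/-! ### Tame primes and the exponent of the different. -/

/-- Over a finite ring whose quotient by a nilpotent maximal ideal `I` has `#R = #(R ⧸ I) ^ e`, with
`e` invertible in the base field, the trace form does not vanish. -/
theorem exists_trace_ne_zero_of_isNilpotent {k R : Type*} [Field k] [CommRing R] [Algebra k R]
    [Finite R] (I : Ideal R) [I.IsMaximal] (hI : IsNilpotent I) {e : ℕ}
    (hcard : Nat.card R = Nat.card (R ⧸ I) ^ e) (he : (e : k) ≠ 0) :
    ∃ x : R, Algebra.trace k R x ≠ 0 := by
  have : Nontrivial R := (Ideal.Quotient.mk_surjective (I := I)).nontrivial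
  have : Finite k := Finite.of_injective _ (algebraMap k R).injective
  have : Finite (R ⧸ I) := .of_surjective _ Ideal.Quotient.mk_surjective
  -- The residue field is separable over the finite field `k`, so it lifts to a coefficient field
  -- inside `R`. Transitivity of the trace then gives `e` times the residue trace on it.
  obtain ⟨f, -⟩ := Algebra.FormallySmooth.exists_lift I hI (AlgHom.id k (R ⧸ I))
  let := f.toRingHom.toAlgebra
  have : IsScalarTower k (R ⧸ I) R := .of_algebraMap_eq fun x ↦ (f.commutes x).symm
  have hrank : Module.finrank (R ⧸ I) R = e := by
    have h := Module.natCard_eq_pow_finrank (K := R ⧸ I) (V := R)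
    rw [hcard] at h
    exact (Nat.pow_right_injective (Finite.one_lt_card : 1 < Nat.card (R ⧸ I)) h).symm
  obtain ⟨y, hy⟩ : ∃ y, Algebra.trace k (R ⧸ I) y ≠ 0 := by
    simpa [LinearMap.ext_iff] using Algebra.trace_ne_zero k (R ⧸ I)
  refine ⟨algebraMap (R ⧸ I) R y, ?_⟩
  rw [← Algebra.trace_trace (S := R ⧸ I), Algebra.trace_algebraMap, hrank, map_nsmul,
    nsmul_eq_mul]
  exact mul_ne_zero he hy

/-- The exponent of a tamely ramified prime in the different is less than its ramification
index. -/
theorem not_pow_dvd_differentIdeal_of_isCoprime {A B : Type*} [CommRing A] [CommRing B]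
    [Algebra A B] [IsDedekindDomain A] [IsDedekindDomain B] [Module.IsTorsionFree A B]
    [Module.Finite A B] [Algebra.IsSeparable (FractionRing A) (FractionRing B)]
    {p : Ideal A} [p.IsMaximal] [Finite (A ⧸ p)] (P Q : Ideal B) [P.IsMaximal] {e : ℕ}
    (hP0 : P ≠ ⊥) (hPQ : IsCoprime P Q) (hP : P ^ e * Q = p.map (algebraMap A B))
    (he : (e : A) ∉ p) : ¬ P ^ e ∣ differentIdeal A B := by
  have hle : p.map (algebraMap A B) ≤ P ^ e := hP ▸ Ideal.mul_le_left
  have hleQ : p.map (algebraMap A B) ≤ Q := hP ▸ Ideal.mul_le_right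
  have hPQe : IsCoprime (P ^ e) Q := hPQ.pow_left
  let : Algebra (A ⧸ p) (B ⧸ P ^ e) :=
    Ideal.Quotient.algebraQuotientOfLEComap (Ideal.map_le_iff_le_comap.mp hle)
  let : Algebra (A ⧸ p) (B ⧸ Q) :=
    Ideal.Quotient.algebraQuotientOfLEComap (Ideal.map_le_iff_le_comap.mp hleQ)
  have : IsScalarTower A (A ⧸ p) (B ⧸ P ^ e) := .of_algebraMap_eq' rfl
  have : IsScalarTower A (A ⧸ p) (B ⧸ Q) := .of_algebraMap_eq' rfl
  have : Module.Finite (A ⧸ p) (B ⧸ P ^ e) := .of_restrictScalars_finite A _ _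
  have : Module.Finite (A ⧸ p) (B ⧸ Q) := .of_restrictScalars_finite A _ _
  have : Finite (B ⧸ P ^ e) := Module.finite_of_finite (A ⧸ p)
  have he0 : e ≠ 0 := by rintro rfl; simp at he
  obtain ⟨x, hx⟩ : ∃ x, Algebra.trace (A ⧸ p) (B ⧸ P ^ e) x ≠ 0 := by
    have hmax : (P.map (Ideal.Quotient.mk (P ^ e))).IsMaximal :=
      Ideal.IsMaximal.map_of_surjective_of_ker_le Ideal.Quotient.mk_surjective
        (by simpa using Ideal.pow_le_self he0)
    refine exists_trace_ne_zero_of_isNilpotent (P.map (Ideal.Quotient.mk (P ^ e))) ⟨e, ?_⟩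
      (e := e) ?_ ?_
    · rw [← Ideal.map_pow, Ideal.map_quotient_self]; rfl
    · rw [Nat.card_congr (DoubleQuot.quotQuotEquivQuotOfLE (Ideal.pow_le_self he0)).toEquiv]
      exact cardQuot_pow_of_prime hP0
    · rwa [← map_natCast (Ideal.Quotient.mk p), ne_eq, Ideal.Quotient.eq_zero_iff_mem]
  let f : (B ⧸ p.map (algebraMap A B)) ≃ₐ[A ⧸ p] ((B ⧸ P ^ e) × B ⧸ Q) :=
    { __ := (Ideal.quotEquivOfEq hP.symm).trans (Ideal.quotientMulEquivQuotientProd _ Q hPQe),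
      commutes' := Quotient.ind fun _ ↦ rfl }
  -- By CRT `y` lies in `Q` and has trace outside `p`. If `P ^ e` divided the different, then `Q = p
  -- P⁻ᵉ` would have all its traces in `p`.
  obtain ⟨y, hy⟩ := Ideal.Quotient.mk_surjective (f.symm (x, 0))
  refine not_dvd_differentIdeal_of_intTrace_not_mem A (P ^ e) Q hP y ?_ ?_
  · have := congr((f $hy).2)
    simp at this
    simpa [f, Ideal.Quotient.eq_zero_iff_mem] using this
  · rw [← Ideal.Quotient.eq_zero_iff_mem, ← Algebra.trace_quotient_eq_of_isDedekindDomain,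
      hy, Algebra.trace_eq_of_algEquiv, Algebra.trace_prod_apply]
    simpa

theorem IsIntegral.of_eq {R : Type*} [CommRing R] {x y : R} (h : IsIntegral ℤ x) (e : x = y) :
    IsIntegral ℤ y :=
  e ▸ h

/-! ### The inverse different at a prime exactly dividing the discriminant. -/

section TraceDual

variable {K : Type*} [Field K] [NumberField K]

variable (K) in
/-- The inverse different of a number field, the dual of its ring of integers with respect to the
trace form. -/
noncomputable abbrev inverseDifferent : FractionalIdeal (𝓞 K)⁰ K :=
  FractionalIdeal.dual ℤ ℚ 1

theorem isIntegral_iff_mem_one {K : Type*} [Field K] {x : K} :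
    IsIntegral ℤ x ↔ x ∈ (1 : FractionalIdeal (𝓞 K)⁰ K) := by
  rw [FractionalIdeal.mem_one_iff]
  exact ⟨fun h ↦ ⟨⟨x, h⟩, rfl⟩, by rintro ⟨y, rfl⟩; exact y.2⟩

theorem mem_inverseDifferent_iff {x : K} :
    x ∈ inverseDifferent K ↔
      ∀ y : K, IsIntegral ℤ y → ∃ n : ℤ, Algebra.trace ℚ K (x * y) = n := by
  rw [FractionalIdeal.mem_dual (one_ne_zero (α := FractionalIdeal (𝓞 K)⁰ K))]
  simp only [← isIntegral_iff_mem_one, Algebra.traceForm_apply, RingHom.mem_range, eq_intCast,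
    eq_comm]

theorem mul_isIntegral_of_mem_differentIdeal {a : 𝓞 K} (ha : a ∈ differentIdeal ℤ (𝓞 K)) {x : K}
    (hx : x ∈ inverseDifferent K) : IsIntegral ℤ ((a : K) * x) := by
  rw [isIntegral_iff_mem_one]
  have h := coeIdeal_differentIdeal ℤ ℚ K (𝓞 K)
  have h1 : (differentIdeal ℤ (𝓞 K) : FractionalIdeal (𝓞 K)⁰ K) * inverseDifferent K = 1 := by
    rw [h, inv_mul_cancel₀ (FractionalIdeal.dual_ne_zero ℤ ℚ
      (one_ne_zero (α := FractionalIdeal (𝓞 K)⁰ K)))]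
  rw [← h1]
  exact FractionalIdeal.mul_mem_mul (FractionalIdeal.mem_coeIdeal_of_mem _ ha) hx

theorem isIntegral_mul_of_mem_inv {P : Ideal (𝓞 K)} (hP : P ≠ ⊥) {w : K} :
    w ∈ (P : FractionalIdeal (𝓞 K)⁰ K)⁻¹ ↔ ∀ a ∈ P, IsIntegral ℤ ((a : K) * w) := by
  rw [FractionalIdeal.mem_inv_iff (by simpa using hP)]
  simp only [← isIntegral_iff_mem_one, FractionalIdeal.mem_coeIdeal, forall_exists_index, and_imp,
    forall_apply_eq_imp_iff₂, mul_comm w]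

theorem mem_inverseDifferent_of_dvd {P : Ideal (𝓞 K)} (hP : P ≠ ⊥)
    (hPD : P ∣ differentIdeal ℤ (𝓞 K)) {w : K} (hw : ∀ a ∈ P, IsIntegral ℤ ((a : K) * w)) :
    w ∈ inverseDifferent K := by
  rw [← isIntegral_mul_of_mem_inv hP] at hw
  have h := coeIdeal_differentIdeal ℤ ℚ K (𝓞 K)
  rw [← inv_inv (inverseDifferent K), ← h]
  refine FractionalIdeal.inv_anti_mono ?_ ?_ ?_ hw
  · simpa using differentIdeal_ne_bot
  · simpa using hP
  · simpa using Ideal.dvd_iff_le.mp hPD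

theorem isIntegral_mul_sq_of_dvd {P : Ideal (𝓞 K)} {n : 𝓞 K} (hn : P ^ 2 ∣ Ideal.span {n}) {w : K}
    (hw : ∀ a ∈ P, IsIntegral ℤ ((a : K) * w)) : IsIntegral ℤ ((n : K) * w ^ 2) := by
  have hn' : n ∈ P * P := by
    rw [← sq]; exact Ideal.dvd_iff_le.mp hn (Ideal.mem_span_singleton_self n)
  refine Submodule.mul_induction_on hn' (fun a ha b hb ↦ ?_) fun x y hx hy ↦ ?_
  · have := (hw a ha).mul (hw b hb)
    refine this.of_eq ?_
    simp only [map_mul]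
    ring
  · have := hx.add hy
    refine this.of_eq ?_
    simp only [map_add]
    ring

/-- A prime dividing the discriminant exactly once has a unique ramified prime above it, which has
degree one and divides the different exactly once. -/
theorem exists_ramified_of_dvd_discr {p : ℕ} (hp : p.Prime) (h1 : (p : ℤ) ∣ NumberField.discr K)
    (h2 : ¬ (p : ℤ) ^ 2 ∣ NumberField.discr K) :
    ∃ (P : Ideal (𝓞 K)) (m : ℕ), P.IsMaximal ∧ P ≠ ⊥ ∧ Ideal.absNorm P = p ∧
      P ∣ differentIdeal ℤ (𝓞 K) ∧ P ^ 2 ∣ Ideal.span {(p : 𝓞 K)} ∧ ¬ p ∣ m ∧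
      ∀ a ∈ P, (m : 𝓞 K) * a ∈ differentIdeal ℤ (𝓞 K) := by
  have hpZ : Prime (p : ℤ) := Nat.prime_iff_prime_int.mp hp
  have hN := NumberField.absNorm_differentIdeal K (𝓞 K)
  obtain ⟨P, hP, hPp, hPD⟩ := Ideal.exists_isMaximal_dvd_of_dvd_absNorm hpZ
    (differentIdeal ℤ (𝓞 K)) (by rw [hN]; exact Int.dvd_natAbs.mpr h1)
  have hP0 : P ≠ ⊥ := by
    rintro rfl
    exact differentIdeal_ne_bot (zero_dvd_iff.mp hPD)
  have hlies : P.LiesOver (Ideal.span {(p : ℤ)}) := ⟨hPp.symm⟩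
  have : (Ideal.span {(p : ℤ)}).IsMaximal :=
    ((Ideal.span_singleton_prime hpZ.ne_zero).mpr hpZ).isMaximal (by simpa using hp.ne_zero)
  obtain ⟨D', hD'⟩ := hPD
  have hN' : Ideal.absNorm P * Ideal.absNorm D' = (NumberField.discr K).natAbs := by
    rw [← map_mul, ← hD', hN]
  have hpdvd : ¬ p ^ 2 ∣ (NumberField.discr K).natAbs := by
    rwa [← Int.natCast_dvd_natCast, Int.dvd_natAbs, Nat.cast_pow]
  have hPN : Ideal.absNorm P = p := by
    have hf := Ideal.absNorm_eq_pow_inertiaDeg P hpZ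
    rw [Int.natAbs_natCast] at hf
    generalize (Ideal.span {(p : ℤ)}).inertiaDeg' P = f at hf
    match f with
    | 0 => exact absurd (Ideal.absNorm_eq_one_iff.mp (by simpa using hf)) hP.ne_top
    | 1 => simpa using hf
    | f + 2 => exact absurd (hN' ▸ hf ▸ ((pow_dvd_pow p (by lia)).mul_right _)) hpdvd
  -- With `D = P D'`, the norm of `D'` lies in `D'`, so it carries `P` into `D`; it is prime to `p`
  -- because `N(D) = |d_K|`.
  refine ⟨P, Ideal.absNorm D', hP, hP0, hPN, ⟨D', hD'⟩, ?_, ?_, ?_⟩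
  · have hle : P ∣ (Ideal.span {(p : ℤ)}).map (algebraMap ℤ (𝓞 K)) :=
      Ideal.dvd_iff_le.mpr (Ideal.map_le_iff_le_comap.mpr hPp.ge)
    obtain ⟨Q, hQ⟩ := hle
    have hPQ : P ∣ Q := by
      by_contra hPQ
      have hPprime := (Ideal.prime_iff_isPrime hP0).mpr hP.isPrime
      rw [← hPprime.irreducible.gcd_eq_one_iff, ← Ideal.isCoprime_iff_gcd] at hPQ
      have : Finite (ℤ ⧸ Ideal.span {(p : ℤ)}) := by
        have := NeZero.mk hp.ne_zero
        exact .of_equiv _ (Int.quotientSpanNatEquivZMod p).symm.toEquiv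
      exact not_dvd_differentIdeal_of_isCoprime ℤ P Q hPQ hQ.symm ⟨D', hD'⟩
    rw [Ideal.map_span, Set.image_singleton] at hQ
    simp only [map_natCast] at hQ
    rw [hQ, sq]
    exact mul_dvd_mul_left P hPQ
  · intro h
    apply hpdvd
    rw [← hN', hPN, sq]
    exact Nat.mul_dvd_mul_left p h
  · intro a ha
    rw [hD', mul_comm (_ : 𝓞 K)]
    exact Ideal.mul_mem_mul ha (Ideal.absNorm_mem D')

/-- If `p` divides the discriminant exactly once, `p u ^ 2` is integral at `p` for all `u` in the
inverse different. -/
theorem exists_isIntegral_mul_sq {p : ℕ} (hp : p.Prime) (h1 : (p : ℤ) ∣ NumberField.discr K)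
    (h2 : ¬ (p : ℤ) ^ 2 ∣ NumberField.discr K) {u : K} (hu : u ∈ inverseDifferent K) :
    ∃ m : ℕ, ¬ p ∣ m ∧ IsIntegral ℤ ((m : K) * (p * u ^ 2)) := by
  obtain ⟨P, m, -, -, -, -, hPp, hm, hmP⟩ := exists_ramified_of_dvd_discr hp h1 h2
  refine ⟨m ^ 2, fun h ↦ hm (hp.dvd_of_dvd_pow h), ?_⟩
  have := isIntegral_mul_sq_of_dvd hPp (w := m * u) fun a ha ↦ by
    have := mul_isIntegral_of_mem_differentIdeal (hmP a ha) hu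
    refine this.of_eq ?_
    push_cast
    ring
  refine this.of_eq ?_
  push_cast
  ring

/-- The residue field has prime order, so it is generated additively by `1`. This makes the
coefficients of `w` rational integers. -/
theorem exists_intCast_sub_mem {P : Ideal (𝓞 K)} {p : ℕ} (hp : p.Prime) (hP : Ideal.absNorm P = p)
    (x : 𝓞 K) : ∃ t : ℤ, x - t ∈ P := by
  have := Fact.mk hp
  have hcard : Nat.card (𝓞 K ⧸ P) = p := hP
  have hne : (1 : 𝓞 K ⧸ P) ≠ 0 := by
    intro h
    have := subsingleton_of_zero_eq_one h.symm
    rw [Nat.card_unique] at hcard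
    exact hp.one_lt.ne hcard
  have htop := zmultiples_eq_top_of_prime_card hcard hne
  obtain ⟨t, ht⟩ : Ideal.Quotient.mk P x ∈ AddSubgroup.zmultiples (1 : 𝓞 K ⧸ P) := by
    rw [htop]; trivial
  refine ⟨t, ?_⟩
  rw [← Ideal.Quotient.eq_zero_iff_mem, map_sub, map_intCast, ← ht]
  simp

/-- If `p` divides the discriminant exactly once, the inverse different modulo the ring of integers
is cyclic at `p`. -/
theorem exists_generator_inverseDifferent {p : ℕ} (hp : p.Prime)
    (h1 : (p : ℤ) ∣ NumberField.discr K) (h2 : ¬ (p : ℤ) ^ 2 ∣ NumberField.discr K) :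
    ∃ (w : K) (m : ℕ), ¬ p ∣ m ∧ w ∈ inverseDifferent K ∧ ¬ IsIntegral ℤ w ∧
      IsIntegral ℤ ((p : K) * w) ∧
      ∀ z ∈ inverseDifferent K, ∃ (a : K) (t : ℤ), IsIntegral ℤ a ∧ (m : K) * z = a + t * w := by
  obtain ⟨P, m, hmax, hP0, hN, hPD, hPp, hm, hmP⟩ := exists_ramified_of_dvd_discr hp h1 h2
  obtain ⟨w, hw, hw1⟩ := FractionalIdeal.exists_notMem_one_of_ne_bot (K := K) hP0 hmax.ne_top
  have hwP := (isIntegral_mul_of_mem_inv hP0).mp hw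
  have hpP : (p : 𝓞 K) ∈ P := by
    rw [← hN]; exact Ideal.absNorm_mem P
  refine ⟨w, m, hm, mem_inverseDifferent_of_dvd hP0 hPD hwP, by rwa [isIntegral_iff_mem_one],
    by simpa using hwP _ hpP, fun z hz ↦ ?_⟩
  -- Otherwise `w P ⊆ P`, and cancelling `P` would make `w` integral. Then `π w` is a unit modulo
  -- `P`.
  obtain ⟨π, hπ, hπw⟩ : ∃ π ∈ P, ∀ u : 𝓞 K, (u : K) = π * w → u ∉ P := by
    by_contra! hcon
    apply hw1
    have hP' : (P : FractionalIdeal (𝓞 K)⁰ K) ≠ 0 := by simpa using hP0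
    have hle : FractionalIdeal.spanSingleton (𝓞 K)⁰ w * P ≤ P := by
      rw [FractionalIdeal.spanSingleton_mul_le_iff]
      intro y hy
      obtain ⟨π, hπ, rfl⟩ := (FractionalIdeal.mem_coeIdeal _).mp hy
      obtain ⟨u, hu, huP⟩ := hcon π hπ
      rw [mul_comm]
      exact (FractionalIdeal.mem_coeIdeal _).mpr ⟨u, huP, hu⟩
    have := mul_le_mul_left hle (P : FractionalIdeal (𝓞 K)⁰ K)⁻¹
    rw [mul_assoc, mul_inv_cancel₀ hP', mul_one] at this
    exact this (FractionalIdeal.mem_spanSingleton_self _ w)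
  set u : 𝓞 K := ⟨π * w, hwP π hπ⟩ with hu
  have huP : u ∉ P := hπw u rfl
  obtain ⟨b, c, hc, hbc⟩ := hmax.exists_inv huP
  have hmz : ∀ a ∈ P, IsIntegral ℤ ((a : K) * (m * z)) := fun a ha ↦ by
    have := mul_isIntegral_of_mem_differentIdeal (hmP a ha) hz
    refine this.of_eq ?_
    push_cast
    ring
  -- With `b` inverse to `π w` modulo `P`, this choice of `t` puts `π (m z - t w)` in `P`.
  obtain ⟨t, ht⟩ := exists_intCast_sub_mem hp hN (b * ⟨π * (m * z), hmz π hπ⟩)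
  set q : 𝓞 K := ⟨π * (m * z), hmz π hπ⟩ with hq
  set v : K := m * z - t * w with hv
  have hπv : q - t * u ∈ P := by
    have : q - t * u = (b * q - t) * u + q * c := by linear_combination -q * hbc
    rw [this]
    exact add_mem (Ideal.mul_mem_right _ _ ht) (Ideal.mul_mem_left _ _ hc)
  have hbc' : (b : K) * (π * w) + c = 1 := by
    exact congrArg (algebraMap (𝓞 K) K) hbc
  have hqv : ((q - t * u : 𝓞 K) : K) = π * v := by
    change (π : K) * (m * z) - t * (π * w) = _
    ring
  refine ⟨v, t, ?_, by ring⟩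
  have hb : IsIntegral ℤ (b : K) := b.2
  have hint := (hb.mul (hwP _ hπv)).add ((hmz c hc).sub ((isIntegral_intCast t).mul (hwP c hc)))
  rw [hqv] at hint
  refine hint.of_eq ?_
  linear_combination v * hbc'

end TraceDual

/-! ### Casimir sums in a basis, and integrality prime by prime. -/

theorem traceCasimirPairing_eq_sum {F K R ι : Type*} [Field F] [Field K] [Algebra F K]
    [FiniteDimensional F K] [Algebra.IsSeparable F K] [Ring R] [Algebra F R] [Fintype ι]
    [DecidableEq ι] (b : Module.Basis ι F K) (ψ φ : K →ₗ[F] R) :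
    traceCasimirPairing F K ψ φ = ∑ i, ψ (b.traceDual i) * φ (b i) := by
  have h1 : (1 : Module.End F K) = dualTensorHomEquiv F K K (∑ i, b.dualBasis i ⊗ₜ[F] b i) := by
    rw [dualTensorHomEquiv_eq_dualTensorHomEquivOfBasis b, dualTensorHomEquivOfBasis_apply]
    ext x
    simp [dualTensorHom_apply, b.sum_repr]
  have h2 (i) : (LinearMap.BilinForm.toDual (Algebra.traceForm F K)
      (traceForm_nondegenerate F K)).symm (b.dualBasis i) = b.traceDual i := rfl
  rw [traceCasimirPairing, casimirPairing, casimirRho, h1]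
  simp only [LinearMap.comp_apply, LinearEquiv.coe_coe, LinearEquiv.symm_apply_apply, map_sum,
    TensorProduct.lift.tmul, LinearMap.compl₁₂_apply, LinearMap.mul_apply', h2]

theorem isIntegral_of_forall_prime {E : Type*} [CommRing E] {x : E}
    (h : ∀ p : ℕ, p.Prime → ∃ m : ℕ, ¬ p ∣ m ∧ IsIntegral ℤ ((m : E) * x)) : IsIntegral ℤ x := by
  -- The multipliers making `x` integral form an ideal of `ℤ`; no prime can divide its generator.
  let I : Ideal ℤ := Submodule.comap (LinearMap.toSpanSingleton ℤ E x)
    (Subalgebra.toSubmodule (integralClosure ℤ E))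
  have hI (n : ℤ) : n ∈ I ↔ IsIntegral ℤ ((n : E) * x) := by
    simp [I, mem_integralClosure_iff]
  obtain ⟨g, hg⟩ := IsPrincipalIdealRing.principal I
  have hgI (n : ℤ) : n ∈ I ↔ g ∣ n := by
    rw [hg]
    exact Ideal.mem_span_singleton
  have hg1 : g.natAbs = 1 := by
    by_contra hne
    obtain ⟨p, hp, hpg⟩ := Nat.exists_prime_and_dvd hne
    obtain ⟨m, hm, hmI⟩ := h p hp
    refine hm (hpg.trans ?_)
    rw [← Int.natAbs_natCast m, Int.natAbs_dvd_natAbs, ← hgI, hI]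
    simpa using hmI
  have := (hI 1).mp ((hgI 1).mpr (Int.natAbs_dvd_natAbs.mp (by simp [hg1])))
  simpa using this

/-! ### The different at tame primes. -/

section Tame

variable {K : Type*} [Field K] [NumberField K]

/-- If all primes above `p` are tamely ramified, the `p`-part of the different divides `p`. -/
theorem exists_mul_mem_differentIdeal_of_tame {p : ℕ} (hp : p.Prime)
    (htame : ∀ P : Ideal (𝓞 K), P.IsPrime → P.LiesOver (Ideal.span {(p : ℤ)}) →
      ¬ p ∣ Ideal.ramificationIdx' (Ideal.span {(p : ℤ)}) P) :
    ∃ m : ℕ, ¬ p ∣ m ∧ (m : 𝓞 K) * p ∈ differentIdeal ℤ (𝓞 K) := by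
  have hpZ : Prime (p : ℤ) := Nat.prime_iff_prime_int.mp hp
  obtain ⟨k, m, hm, hd⟩ := Nat.exists_eq_pow_mul_and_not_dvd
    (n := (NumberField.discr K).natAbs) (by simpa using NumberField.discr_ne_zero K) p hp.ne_one
  refine ⟨m, hm, ?_⟩
  have hdD : differentIdeal ℤ (𝓞 K) ∣ Ideal.span {(p : 𝓞 K)} ^ k * Ideal.span {(m : 𝓞 K)} := by
    rw [Ideal.span_singleton_pow, Ideal.span_singleton_mul_span_singleton, Ideal.dvd_span_singleton]
    have := Ideal.absNorm_mem (differentIdeal ℤ (𝓞 K))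
    rw [NumberField.absNorm_differentIdeal K, hd] at this
    exact_mod_cast this
  rw [← Ideal.dvd_span_singleton, ← Ideal.span_singleton_mul_span_singleton,
    UniqueFactorizationMonoid.dvd_iff_emultiplicity_le differentIdeal_ne_bot]
  intro Q hQ
  have hQ0 : Q ≠ ⊥ := hQ.ne_zero
  have hQp : Q.IsPrime := Ideal.isPrime_of_prime hQ
  have hQm : Q.IsMaximal := hQp.isMaximal hQ0
  -- Above `p`, tameness bounds the exponent of `Q` in the different by `e`. Away from `p`, the
  -- bound comes from `D ∣ p ^ k m`.
  refine emultiplicity_le_emultiplicity_iff.mpr fun n hn ↦ ?_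
  by_cases hpQ : Q ∣ Ideal.span {(p : 𝓞 K)}
  · refine Dvd.dvd.mul_left ?_ _
    have hpmem : (p : 𝓞 K) ∈ Q := Ideal.dvd_span_singleton.mp hpQ
    have hlies : Q.LiesOver (Ideal.span {(p : ℤ)}) :=
      (Ideal.liesOver_span_iff hQp.ne_top hpZ).mpr (by simpa using hpmem)
    have hmap : (Ideal.span {(p : ℤ)}).map (algebraMap ℤ (𝓞 K)) = Ideal.span {(p : 𝓞 K)} := by
      simp [Ideal.map_span]
    have hp0 : Ideal.span {(p : 𝓞 K)} ≠ 0 := by simpa using hp.ne_zero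
    obtain ⟨e, R, hR, he⟩ := WfDvdMonoid.max_power_factor hp0 hQ.irreducible
    have hidx : Ideal.ramificationIdx' (Ideal.span {(p : ℤ)}) Q = e := by
      refine Ideal.ramificationIdx'_spec ?_ ?_
      · rw [hmap, he]; exact Ideal.mul_le_left
      · rw [hmap, ← Ideal.dvd_iff_le, he, pow_succ,
          mul_dvd_mul_iff_left (pow_ne_zero _ hQ.ne_zero)]
        exact hR
    have hcop : IsCoprime Q R := by
      rwa [← hQ.irreducible.gcd_eq_one_iff, ← Ideal.isCoprime_iff_gcd] at hR
    have : (Ideal.span {(p : ℤ)}).IsMaximal :=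
      ((Ideal.span_singleton_prime hpZ.ne_zero).mpr hpZ).isMaximal (by simpa using hp.ne_zero)
    have : Finite (ℤ ⧸ Ideal.span {(p : ℤ)}) := by
      have := NeZero.mk hp.ne_zero
      exact .of_equiv _ (Int.quotientSpanNatEquivZMod p).symm.toEquiv
    have hnot := not_pow_dvd_differentIdeal_of_isCoprime (p := Ideal.span {(p : ℤ)}) Q R (e := e)
      hQ0 hcop (hmap ▸ he.symm) (by
        rw [Ideal.mem_span_singleton, Int.natCast_dvd_natCast, ← hidx]
        exact htame Q hQp hlies)
    have hne : n ≤ e := by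
      by_contra! hlt
      exact hnot ((pow_dvd_pow Q hlt.le).trans hn)
    rw [he]
    exact (pow_dvd_pow Q hne).mul_right R
  · refine Dvd.dvd.mul_right ?_ _
    rw [← hQ.irreducible.gcd_eq_one_iff, ← Ideal.isCoprime_iff_gcd] at hpQ
    exact (hpQ.pow (m := n) (n := k)).dvd_of_dvd_mul_left (hn.trans hdD)

end Tame

/-! ### Invariants preserved by the isometry. -/

section Isometry

variable {K L : Type*} [Field K] [NumberField K] [Field L] [NumberField L] {φ : K ≃ₗ[ℚ] L}

namespace IsIntegralTraceIsometry

theorem isIntegral_iff (hφ : IsIntegralTraceIsometry φ) {x : K} :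
    IsIntegral ℤ (φ x) ↔ IsIntegral ℤ x := by
  change φ x ∈ {y : L | IsIntegral ℤ y} ↔ x ∈ {x : K | IsIntegral ℤ x}
  rw [← hφ.image_integers, φ.injective.mem_set_image]

theorem map_mem_inverseDifferent (hφ : IsIntegralTraceIsometry φ) {x : K}
    (hx : x ∈ inverseDifferent K) : φ x ∈ inverseDifferent L := by
  rw [mem_inverseDifferent_iff] at hx ⊢
  intro y hy
  obtain ⟨z, rfl⟩ := φ.surjective y
  rw [hφ.trace_eq]
  exact hx z (hφ.isIntegral_iff.mp hy)

theorem discr_eq (hφ : IsIntegralTraceIsometry φ) : NumberField.discr L = NumberField.discr K := by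
  let f : 𝓞 K →+ 𝓞 L :=
    { toFun := fun x ↦ ⟨φ x, hφ.isIntegral_iff.mpr x.2⟩
      map_zero' := Subtype.ext (map_zero φ)
      map_add' := fun x y ↦ Subtype.ext (map_add φ _ _) }
  have hf : Function.Bijective f := by
    refine ⟨fun x y h ↦ NumberField.RingOfIntegers.ext (φ.injective congr(($h : L))), fun y ↦ ?_⟩
    refine ⟨⟨φ.symm y, hφ.isIntegral_iff.mp ((φ.apply_symm_apply (y : L)).symm ▸ y.2)⟩, ?_⟩
    exact NumberField.RingOfIntegers.ext (φ.apply_symm_apply y)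
  let e : 𝓞 K ≃ₗ[ℤ] 𝓞 L := LinearEquiv.ofBijective f.toIntLinearMap hf
  let b := NumberField.RingOfIntegers.basis K
  rw [← NumberField.discr_eq_discr L (b.map e), ← NumberField.discr_eq_discr K b, Algebra.discr_def,
    Algebra.discr_def]
  congr 1
  ext i j
  rw [Algebra.traceMatrix_apply, Algebra.traceMatrix_apply, Algebra.traceForm_apply,
    Algebra.traceForm_apply, ← Int.cast_inj (α := ℚ), Algebra.coe_trace_int, Algebra.coe_trace_int]
  exact hφ.trace_eq _ _

end IsIntegralTraceIsometry

end Isometry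

/-! ### The Casimir element at one prime. -/

section Local

variable {K E : Type*} [Field K] [NumberField K] [Field E] [Algebra ℚ E]

theorem traceDual_integralBasis_mem_inverseDifferent (i) :
    (NumberField.integralBasis K).traceDual i ∈ inverseDifferent K := by
  rw [mem_inverseDifferent_iff]
  intro y hy
  refine ⟨(NumberField.RingOfIntegers.basis K).repr ⟨y, hy⟩ i, ?_⟩
  rw [mul_comm, ← Algebra.traceForm_apply, ← Module.Basis.traceDual_repr_apply,
    Module.Basis.traceDual_traceDual]
  exact NumberField.integralBasis_repr_apply K ⟨y, hy⟩ i

theorem isIntegral_integralBasis (i) : IsIntegral ℤ (NumberField.integralBasis K i) := by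
  rw [NumberField.integralBasis_apply]
  exact NumberField.RingOfIntegers.isIntegral_coe _

theorem isIntegral_natCast_mul_traceCasimirPairing (ψ : K →ₐ[ℚ] E) (j : K →ₗ[ℚ] E)
    (hj : ∀ x, IsIntegral ℤ x → IsIntegral ℤ (j x)) {n : ℕ}
    (hn : (n : 𝓞 K) ∈ differentIdeal ℤ (𝓞 K)) :
    IsIntegral ℤ ((n : E) * traceCasimirPairing ℚ K ψ.toLinearMap j) := by
  rw [traceCasimirPairing_eq_sum (NumberField.integralBasis K), Finset.mul_sum]
  refine IsIntegral.sum _ fun i _ ↦ ?_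
  have h1 := mul_isIntegral_of_mem_differentIdeal hn
    (traceDual_integralBasis_mem_inverseDifferent i)
  refine ((h1.map (ψ.restrictScalars ℤ)).mul (hj _ (isIntegral_integralBasis i))).of_eq ?_
  simp [mul_assoc]

/-- If `p` divides the discriminant exactly once and `p j(u) ^ 2` is integral at `p` for all `u` in
the inverse different, then the Casimir pairing is integral at `p`. -/
theorem exists_isIntegral_mul_traceCasimirPairing (ψ : K →ₐ[ℚ] E) (j : K →ₗ[ℚ] E)
    (hj : ∀ x, IsIntegral ℤ x → IsIntegral ℤ (j x)) {p : ℕ} (hp : p.Prime)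
    (h1 : (p : ℤ) ∣ NumberField.discr K) (h2 : ¬ (p : ℤ) ^ 2 ∣ NumberField.discr K)
    (hsq : ∀ u ∈ inverseDifferent K, ∃ m : ℕ, ¬ p ∣ m ∧ IsIntegral ℤ ((m : E) * (p * j u ^ 2))) :
    ∃ m : ℕ, ¬ p ∣ m ∧ IsIntegral ℤ ((m : E) * traceCasimirPairing ℚ K ψ.toLinearMap j) := by
  obtain ⟨w, m, hm, hw, hw_int, hpw, hgen⟩ := exists_generator_inverseDifferent hp h1 h2
  obtain ⟨m₁, hm₁, hw₁⟩ := exists_isIntegral_mul_sq hp h1 h2 hw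
  obtain ⟨m₂, hm₂, hw₂⟩ := hsq w hw
  have hpK : (p : K) ≠ 0 := Nat.cast_ne_zero.mpr hp.ne_zero
  set b := NumberField.integralBasis K with hb
  choose a t ha hat using fun i ↦ hgen _ (traceDual_integralBasis_mem_inverseDifferent (K := K) i)
  set y : K := ∑ i, (t i : ℚ) • b i with hy
  -- For integral `z` with `nᵢ = Tr(z vᵢ)`, the integer `∑ nᵢ tᵢ` is both `Tr(y z)` and the
  -- coefficient of `w` in `m z`. Since `p w` is integral and `w` is not, `p` divides it.
  have hyp : (p : ℚ)⁻¹ • y ∈ inverseDifferent K := by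
    rw [mem_inverseDifferent_iff]
    intro z hz
    choose n hn using fun i ↦ (mem_inverseDifferent_iff.mp
      (FractionalIdeal.one_le_dual_one ℤ ℚ (isIntegral_iff_mem_one.mp hz))) (b i)
      (isIntegral_integralBasis i)
    have hmz : (m : K) * z = ∑ i, n i * a i + (∑ i, n i * t i : ℤ) * w := by
      have hz' : z = ∑ i, (n i : K) * b.traceDual i := by
        conv_lhs => rw [← b.traceDual.sum_repr z]
        refine Finset.sum_congr rfl fun i _ ↦ ?_
        rw [Module.Basis.traceDual_repr_apply, Algebra.traceForm_apply, hn, Algebra.smul_def,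
          map_intCast]
      rw [hz']
      push_cast
      rw [Finset.mul_sum, Finset.sum_mul, ← Finset.sum_add_distrib]
      refine Finset.sum_congr rfl fun i _ ↦ ?_
      linear_combination (n i : K) * hat i
    have htr : Algebra.trace ℚ K (y * z) = (∑ i, n i * t i : ℤ) := by
      rw [hy, Finset.sum_mul, map_sum]
      push_cast
      refine Finset.sum_congr rfl fun i _ ↦ ?_
      rw [smul_mul_assoc, map_smul, mul_comm (b i), hn, smul_eq_mul, mul_comm]
    have hNw : IsIntegral ℤ (((∑ i, n i * t i : ℤ) : K) * w) := by
      refine (((isIntegral_natCast (a := m)).mul hz).sub (IsIntegral.sum (s := Finset.univ)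
        (fun i ↦ (n i : K) * a i) fun i _ ↦ (isIntegral_intCast (n i)).mul (ha i))).of_eq ?_
      rw [hmz]
      ring
    obtain ⟨N, hN⟩ : (p : ℤ) ∣ ∑ i, n i * t i := by
      by_contra hndvd
      obtain ⟨r, s, hrs⟩ := (Nat.prime_iff_prime_int.mp hp).coprime_iff_not_dvd.mpr hndvd
      refine hw_int
        ((((isIntegral_intCast r).mul hpw).add ((isIntegral_intCast s).mul hNw)).of_eq ?_)
      have hrs' : (r : K) * p + s * (∑ i, n i * t i : ℤ) = 1 := by
        exact_mod_cast congrArg (Int.cast (R := K)) hrs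
      linear_combination w * hrs'
    refine ⟨N, ?_⟩
    rw [smul_mul_assoc, map_smul, htr, hN]
    have : (p : ℚ) ≠ 0 := Nat.cast_ne_zero.mpr hp.ne_zero
    push_cast
    simp [this]
  obtain ⟨a', t', ha', hat'⟩ := hgen _ hyp
  have hmc : (m : E) * traceCasimirPairing ℚ K ψ.toLinearMap j =
      ∑ i, ψ (a i) * j (b i) + ψ w * j y := by
    rw [traceCasimirPairing_eq_sum b, hy, map_sum, Finset.mul_sum, Finset.mul_sum,
      ← Finset.sum_add_distrib]
    refine Finset.sum_congr rfl fun i _ ↦ ?_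
    have := congrArg ψ (hat i)
    simp only [map_mul, map_add, map_natCast, map_intCast] at this
    rw [map_smul, Algebra.smul_def, map_intCast, AlgHom.toLinearMap_apply]
    linear_combination j (b i) * this
  have hmy : (m : E) * j y = p * j a' + p * t' * j w := by
    have hE (q : ℤ) (x : K) : j (q * x) = q * j x := by
      rw [← zsmul_eq_mul, map_zsmul, zsmul_eq_mul]
    have hy' : ((m : ℤ) : K) * y = (p : ℤ) * a' + (p * t' : ℤ) * w := by
      rw [Algebra.smul_def, map_inv₀, map_natCast] at hat'
      push_cast
      field_simp at hat'
      linear_combination hat'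
    have := congrArg j hy'
    rw [map_add, hE, hE, hE] at this
    exact_mod_cast this
  have hprod : IsIntegral ℤ (((m₁ * m₂ : ℕ) : E) * (p * (ψ w * j w))) := by
    refine IsIntegral.of_pow (n := 2) two_pos ?_
    refine (((hw₁.map (ψ.restrictScalars ℤ)).mul hw₂).mul
      (isIntegral_natCast (a := m₁ * m₂))).of_eq ?_
    simp
    ring
  -- One `m` reduces the `vᵢ*` to multiples of `w`, the other does so for `y / p`; `m₁` and `m₂`
  -- clear `p w²` and `p j(w)²`.
  refine ⟨m ^ 2 * (m₁ * m₂), ?_, ?_⟩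
  · rw [hp.dvd_mul, hp.dvd_mul]
    rintro (h | h | h)
    exacts [hm (hp.dvd_of_dvd_pow h), hm₁ h, hm₂ h]
  · have hsum : IsIntegral ℤ (∑ i, ψ (a i) * j (b i)) := IsIntegral.sum _ fun i _ ↦
      ((ha i).map (ψ.restrictScalars ℤ)).mul (hj _ (isIntegral_integralBasis i))
    have hpw' := (hpw.map (ψ.restrictScalars ℤ)).mul (hj _ ha')
    refine (((isIntegral_natCast (a := m₁ * m₂ * m)).mul hsum).add
      (((isIntegral_natCast (a := m₁ * m₂)).mul hpw').add
        ((isIntegral_intCast t').mul hprod))).of_eq ?_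
    simp only [AlgHom.restrictScalars_apply, map_mul, map_natCast]
    push_cast
    linear_combination -(m₁ * m₂ * m : E) * hmc - (m₁ * m₂ * ψ w : E) * hmy

end Local

end Different

/-! ### Assembling the three statements. -/

theorem dvd_exactPrimePart_iff {p : ℕ} (hp : p.Prime) {d : ℤ} (hd : d ≠ 0) :
    p ∣ exactPrimePart d ↔ (p : ℤ) ∣ d ∧ ¬ (p : ℤ) ^ 2 ∣ d := by
  have h1 : (p : ℤ) ∣ d ↔ p ∣ d.natAbs := Int.natCast_dvd
  have h2 : (p : ℤ) ^ 2 ∣ d ↔ p ^ 2 ∣ d.natAbs := by rw [← Int.natCast_dvd]; push_cast; rfl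
  rw [h1, h2, exactPrimePart, hp.prime.dvd_finsetProd_iff]
  constructor
  · rintro ⟨q, hq, hpq⟩
    rw [Finset.mem_filter, Nat.mem_primeFactors] at hq
    obtain rfl := (Nat.prime_dvd_prime_iff_eq hp hq.1.1).mp hpq
    exact ⟨hq.1.2.1, hq.2⟩
  · rintro ⟨h, h'⟩
    exact ⟨p, by simp [hp, h, h', hd], dvd_rfl⟩

theorem theorem3p3 {K L E : Type*} [Field K] [NumberField K] [Field L] [NumberField L]
    [Field E] [NumberField E]
    (ιK : K →ₐ[ℚ] E) (ιL : L →ₐ[ℚ] E) (hE : ιK.fieldRange ⊔ ιL.fieldRange = ⊤)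
    (φ : K ≃ₗ[ℚ] L) (hφ : IsIntegralTraceIsometry φ)
    (c : E) (hc : c = traceCasimirPairing ℚ K ιK.toLinearMap (ιL.toLinearMap ∘ₗ φ.toLinearMap))
    (ds : ℤ) (hds : NumberField.discr K = ds * (exactPrimePart (NumberField.discr K) : ℤ)) :
    IsIntegral ℤ ((ds : E) * c) ∧
    (NoWildRamification K →
      IsIntegral ℤ (((UniqueFactorizationMonoid.radical ds : ℤ) : E) * c)) ∧
    (Squarefree (NumberField.discr K) → IsIntegral ℤ c) := by
  set d := NumberField.discr K with hd
  have hd0 : d ≠ 0 := NumberField.discr_ne_zero K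
  have hds0 : ds ≠ 0 := by rintro rfl; simp [hd0] at hds
  have hj (x : K) (hx : IsIntegral ℤ x) :
      IsIntegral ℤ ((ιL.toLinearMap ∘ₗ φ.toLinearMap) x) :=
    (hφ.isIntegral_iff.mpr hx).map (ιL.restrictScalars ℤ)
  have hmul {x : E} (hx : IsIntegral ℤ x) (a : ℤ) : IsIntegral ℤ ((a : E) * x) :=
    (isIntegral_intCast a).mul hx
  have hexact (p : ℕ) (hp : p.Prime) (h1 : (p : ℤ) ∣ d) (h2 : ¬ (p : ℤ) ^ 2 ∣ d) :
      ∃ m : ℕ, ¬ p ∣ m ∧ IsIntegral ℤ ((m : E) * c) := by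
    rw [hc]
    refine exists_isIntegral_mul_traceCasimirPairing ιK _ hj hp h1 h2 fun u hu ↦ ?_
    obtain ⟨m, hm, hint⟩ := exists_isIntegral_mul_sq hp (hφ.discr_eq ▸ h1) (hφ.discr_eq ▸ h2)
      (hφ.map_mem_inverseDifferent hu)
    refine ⟨m, hm, (hint.map (ιL.restrictScalars ℤ)).of_eq ?_⟩
    simp
  have hdc : IsIntegral ℤ ((d.natAbs : E) * c) := by
    rw [hc]
    refine isIntegral_natCast_mul_traceCasimirPairing ιK _ hj ?_
    rw [← NumberField.absNorm_differentIdeal K (𝓞 K)]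
    exact Ideal.absNorm_mem _
  have hunram (p : ℕ) (h1 : ¬ (p : ℤ) ∣ d) : ∃ m : ℕ, ¬ p ∣ m ∧ IsIntegral ℤ ((m : E) * c) :=
    ⟨d.natAbs, by rwa [← Int.natCast_dvd], hdc⟩
  have hscale {p : ℕ} (a : ℤ) (h : ∃ m : ℕ, ¬ p ∣ m ∧ IsIntegral ℤ ((m : E) * c)) :
      ∃ m : ℕ, ¬ p ∣ m ∧ IsIntegral ℤ ((m : E) * ((a : E) * c)) := by
    obtain ⟨m, hm, hint⟩ := h
    exact ⟨m, hm, (hmul hint a).of_eq (by ring)⟩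
  refine ⟨isIntegral_of_forall_prime fun p hp ↦ ?_,
    fun htame ↦ isIntegral_of_forall_prime fun p hp ↦ ?_,
    fun hsqf ↦ isIntegral_of_forall_prime fun p hp ↦ ?_⟩
  · by_cases hpe : (p : ℤ) ∣ d ∧ ¬ (p : ℤ) ^ 2 ∣ d
    · exact hscale ds (hexact p hp hpe.1 hpe.2)
    -- The cofactor of `ds` in `d` is prime to `p`, and `d c` is already integral.
    · refine ⟨exactPrimePart d, by rwa [dvd_exactPrimePart_iff hp hd0], ?_⟩
      have hcast : ((exactPrimePart d : ℕ) : E) * (ds * c) = (d : E) * c := by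
        rw [← mul_assoc, mul_comm _ (ds : E)]
        exact_mod_cast congrArg (fun n : ℤ ↦ (n : E) * c) hds.symm
      rw [hcast]
      obtain h | h := d.natAbs_eq
      · exact hdc.of_eq (by rw [h]; simp)
      · exact hdc.neg.of_eq (by rw [h]; simp)
  · by_cases hpd : (p : ℤ) ∣ d
    · by_cases hpe : (p : ℤ) ^ 2 ∣ d
      · obtain ⟨m, hm, hmD⟩ := exists_mul_mem_differentIdeal_of_tame (K := K) hp
          fun P hP hlies ↦ htame p P hp hP hlies
        have hpds : (p : ℤ) ∣ ds := by
          have hpZ := Nat.prime_iff_prime_int.mp hp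
          refine (hpZ.dvd_or_dvd (hds ▸ hpd)).resolve_right fun h ↦ ?_
          rw [Int.natCast_dvd_natCast, dvd_exactPrimePart_iff hp hd0] at h
          exact h.2 hpe
        -- The radical of `ds` supplies the single factor `p` needed at a tame prime.
        obtain ⟨s, hs⟩ := (UniqueFactorizationMonoid.dvd_radical_iff_of_irreducible
          (Nat.prime_iff_prime_int.mp hp).irreducible hds0).mpr hpds
        have hint := isIntegral_natCast_mul_traceCasimirPairing ιK _ hj (n := m * p)
          (by exact_mod_cast hmD)
        rw [← hc] at hint
        refine ⟨m, hm, (hmul hint s).of_eq ?_⟩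
        rw [hs]
        push_cast
        ring
      · exact hscale _ (hexact p hp hpd hpe)
    · exact hscale _ (hunram p hpd)
  · by_cases hpd : (p : ℤ) ∣ d
    · refine hexact p hp hpd fun h ↦ ?_
      rw [sq] at h
      exact (Nat.prime_iff_prime_int.mp hp).not_isUnit (hsqf _ h)
    · exact hunram p hpd
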